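/- Conventions. All maps are continuous. Paracompact spaces are Hausdorff. Multivalued mappings have non-empty values. For a CW-complex $L$ and a space $X$, write $\text{e-dim}\,X\le[L]$ if every map from a closed subspace of $X$ to $L$ extends to a map $X\to L$. Write $[L]\le[S^n]$ if $\text{e-dim}\,X\le[L]$ implies $\text{e-dim}\,X\le[S^n]$ for every paracompact space $X$. A pair $V\subset U$ of spaces is $[L]$-connected if for every paracompact space $Z$ with $\text{e-dim}\,Z\le[L]$ and every closed $A\subset Z$, every map $A\to V$ extends to a map $Z\to U$. A pair $K\subset K'$ of subspaces of $Y$ is $UV^{[L]}$-connected in $Y$ if every neighbourhood $U$ of $K'$ in $Y$ contains a neighbourhood $V$ of $K$ such that the pair $V\subset U$ is $[L]$-connected. A multivalued mapping $F\colon X\to Y$ is compact if its values are compact and it is upper semicontinuous, that is, for every $x\in X$ and every open $V\supset F(x)$ there is a neighbourhood $O$ of $x$ with $F(x')\subset V$ for all $x'\in O$. A compact $UV^{[L]}$-connected $n$-filtration of $F$ is a sequence of compact multivalued mappings $F_0,\dots,F_n\colon X\to Y$ such that for every $x\in X$ we have $F_0(x)\subset F_1(x)\subset\dots\subset F_n(x)\subset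 F(x)$ and, for every $i<n$, the pair $F_i(x)\subset F_{i+1}(x)$ is $UV^{[L]}$-connected in $Y$. A space $M$ belongs to $ANE([L])$ if for every paracompact space $Z$ with $\text{e-dim}\,Z\le[L]$ and every closed $A\subset Z$, every map $A\to M$ extends to a map $O\to M$ of some neighbourhood $O$ of $A$ in $Z$. A surjective map $f\colon Y\to X$ of metric spaces is approximately $[L]$-invertible if the following holds for all metric spaces $M\in ANE([L])$ and $N$, and for all topological embeddings $X\subset M$ and $Y\subset M\times N$ such that $f$ is the restriction to $Y$ of the projection $p\colon M\times N\to M$: for every neighbourhood $W$ of $Y$ in $M\times N$ there is an open neighbourhood $U$ of $X$ in $M$ such that for every paracompact space $Z$ with $\text{e-dim}\,Z\le[L]$ and every map $g\colon Z\to U$ there is a map $g'\colon Z\to W$ with $p\circ g'=g$. Theorem. Let $L$ be a CW-complex such that $[L]\le[S^n]$ for some integer $n\ge 0$. Let $f\colon Y\to X$ be a continuous surjective map of metric spaces such that the multivalued mapping $F=f^{-1}\colon X\to Y$ admits a compact $UV^{[L]}$-connected $n$-filtration. Then $f$ is approximately $[L]$-invertible. -/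

import Mathlib

open Topology Set

universe u v w

/-- `e-dim X ≤ [L]`: every map of a closed subspace of `X` into `L` extends over `X`. -/
def ExtDimLE (X : Type u) [TopologicalSpace X] (L : Type v) [TopologicalSpace L] : Prop :=
  ∀ A : Set X, IsClosed A → ∀ φ : C(A, L), ∃ ψ : C(X, L), ψ.restrict A = φ

/-- `[L] ≤ [K]`: for all paracompact (Hausdorff) spaces, `e-dim ≤ [L]` implies `e-dim ≤ [K]`. -/
def ExtTypeLE (L : Type v) [TopologicalSpace L] (K : Type w) [TopologicalSpace K] : Prop :=
  ∀ (X : Type u) [TopologicalSpace X] [T2Space X] [ParacompactSpace X],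
    ExtDimLE X L → ExtDimLE X K

/-- The unit sphere `S^n` of `ℝ^(n+1)`. -/
abbrev StdSphere (n : ℕ) : Type := Metric.sphere (0 : EuclideanSpace ℝ (Fin (n + 1))) 1

/-- The pair of subspaces `V ⊆ U` of `Y` is `[L]`-connected: for every paracompact space `Z` with
`e-dim Z ≤ [L]` and every closed `A ⊆ Z`, every map of `A` into `V` extends to a map of `Z`
into `U`. -/
def IsLConnectedPair (L : Type v) [TopologicalSpace L] {Y : Type u} [TopologicalSpace Y]
    (V U : Set Y) : Prop :=
  V ⊆ U ∧
    ∀ (Z : Type u) [TopologicalSpace Z] [T2Space Z] [ParacompactSpace Z], ExtDimLE Z L →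
      ∀ A : Set Z, IsClosed A → ∀ φ : C(A, Y), (∀ a, φ a ∈ V) →
        ∃ ψ : C(Z, Y), (∀ z, ψ z ∈ U) ∧ ψ.restrict A = φ

/-- The pair `K ⊆ K'` of subspaces of `Y` is `UV^[L]`-connected in `Y`: every neighbourhood `U` of
`K'` contains a neighbourhood `V` of `K` such that the pair `V ⊆ U` is `[L]`-connected. -/
def IsUVConnectedPair (L : Type v) [TopologicalSpace L] {Y : Type u} [TopologicalSpace Y]
    (K K' : Set Y) : Prop :=
  K ⊆ K' ∧ ∀ U ∈ 𝓝ˢ K', ∃ V ∈ 𝓝ˢ K, IsLConnectedPair L V U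

/-- A compact multivalued mapping (with non-empty values): upper semicontinuous with compact
values. Upper semicontinuity says that whenever `U` is a neighbourhood of `F x`, it is a
neighbourhood of `F x'` for all `x'` close to `x`. -/
structure IsCompactMultimap {X Y : Type*} [TopologicalSpace X] [TopologicalSpace Y]
    (F : X → Set Y) : Prop where
  nonempty : ∀ x, (F x).Nonempty
  isCompact : ∀ x, IsCompact (F x)
  usc : UpperHemicontinuous F

/-- The multivalued mappings `G 0, …, G n` form a filtration of `F`:
`G 0 x ⊆ G 1 x ⊆ … ⊆ G n x ⊆ F x` for every `x`. -/
structure IsMultimapFiltration {X Y : Type*} {n : ℕ}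
    (G : Fin (n + 1) → X → Set Y) (F : X → Set Y) : Prop where
  step : ∀ (i : Fin n) (x : X), G i.castSucc x ⊆ G i.succ x
  last : ∀ x, G (Fin.last n) x ⊆ F x

/-- The multivalued mapping `F : X → Y` admits a compact `UV^[L]`-connected `n`-filtration. -/
def AdmitsCompactUVFiltration (L : Type v) [TopologicalSpace L] (n : ℕ) {X Y : Type u}
    [TopologicalSpace X] [TopologicalSpace Y] (F : X → Set Y) : Prop :=
  ∃ G : Fin (n + 1) → X → Set Y,
    IsMultimapFiltration G F ∧
    (∀ i, IsCompactMultimap (G i)) ∧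
    ∀ (i : Fin n) (x : X), IsUVConnectedPair L (G i.castSucc x) (G i.succ x)

/-- The map `f : Y → X` is locally `[L]`-soft: for every paracompact space `Z` with
`e-dim Z ≤ [L]`, every closed `A ⊆ Z`, and all maps `g : Z → X` and `gA : A → Y` with
`f ∘ gA = g|A`, there are an open `O ⊇ A` and a map `h : O → Y` extending `gA` with
`f ∘ h = g|O`. -/
def IsLocallyLSoft (L : Type v) [TopologicalSpace L] {X Y : Type u}
    [TopologicalSpace X] [TopologicalSpace Y] (f : Y → X) : Prop :=
  ∀ (Z : Type u) [TopologicalSpace Z] [T2Space Z] [ParacompactSpace Z], ExtDimLE Z L →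
    ∀ A : Set Z, IsClosed A → ∀ (g : C(Z, X)) (gA : C(A, Y)), (∀ a : A, f (gA a) = g a) →
      ∃ (O : Set Z) (_ : IsOpen O) (hAO : A ⊆ O) (h : C(O, Y)),
        (∀ a : A, h ⟨a, hAO a.2⟩ = gA a) ∧ ∀ z : O, f (h z) = g z

/-- `M ∈ ANE([L])`: the constant map of `M` to a point is locally `[L]`-soft. -/
def IsLANE (L : Type v) [TopologicalSpace L] (M : Type u) [TopologicalSpace M] : Prop :=
  IsLocallyLSoft L (fun _ : M => PUnit.unit.{u + 1})

/-- The map `f : Y → X` is approximately `[L]`-invertible. The embeddings `i : X → M` and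
`j : Y → M × N` form an embedding of `f` into the projection `M × N → M`. -/
def IsApproxLInvertible (L : Type v) [TopologicalSpace L] {X Y : Type u}
    [TopologicalSpace X] [TopologicalSpace Y] (f : Y → X) : Prop :=
  ∀ (M N : Type u) [MetricSpace M] [MetricSpace N], IsLANE L M →
    ∀ (i : X → M) (j : Y → M × N), IsEmbedding i → IsEmbedding j → (∀ y, (j y).1 = i (f y)) →
      ∀ W ∈ 𝓝ˢ (range j), ∃ U : Set M, IsOpen U ∧ range i ⊆ U ∧
        ∀ (Z : Type u) [TopologicalSpace Z] [T2Space Z] [ParacompactSpace Z], ExtDimLE Z L →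
          ∀ g : C(Z, M), (∀ z, g z ∈ U) →
            ∃ g' : C(Z, M × N), (∀ z, g' z ∈ W) ∧ ∀ z, (g' z).1 = g z

/-! Write `H m = G (n - m)`, so that `H 0` is the largest member of the filtration. Start from
neighbourhoods `U 0 x` of `H 0 x` whose graph over `P 0 x` lies in `W`. `UV`-connectedness gives a
neighbourhood `V m x` of `H (m + 1) x` with `V m x ⊆ U m x` `[L]`-connected. Upper semicontinuity
then gives the next neighbourhoods `U (m + 1) y`, contained in every `V m x` for which `Q m x` meets
`P (m + 1) y` (`exists_nested_isGraphCover`). The required open set is the intersection of the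
unions of the `Q m x` over `m ≤ n`.

Given `g : Z → M` into this set, `[L] ≤ [S^n]` gives a locally finite closed cover of `Z`, of order
at most `n + 1`, refining the pulled-back covers (`ExtDimLE.exists_closed_refinement`). A map `h : Z
→ Y` is built on its `m`-fold intersections for decreasing `m`, with values in sets `U (m - 1) x`;
each step extends from deeper intersections by `[L]`-connectedness
(`exists_continuous_of_closed_cover`). Then `z ↦ (g z, (j (h z)).2)` lifts `g` into `W`. -/

/-! ### Extension dimension at most `[S^n]` and the order of covers -/

theorem ExtDimLE.of_isClosed {Z : Type u} [TopologicalSpace Z] {L : Type v} [TopologicalSpace L]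
    (hZ : ExtDimLE Z L) {D : Set Z} (hD : IsClosed D) : ExtDimLE D L := by
  intro A hA φ
  have hemb : IsClosedEmbedding (Subtype.val : D → Z) := hD.isClosedEmbedding_subtypeVal
  have hcl : IsClosed (Subtype.val '' A : Set Z) := hemb.isClosedMap A hA
  have hemb' : IsClosedEmbedding ((fun a : A => ((a : D) : Z))) :=
    hemb.comp hA.isClosedEmbedding_subtypeVal
  let e : A ≃ₜ (Subtype.val '' A : Set Z) :=
    (hemb.isEmbedding.homeomorphImage A)
  obtain ⟨ψ, hψ⟩ := hZ _ hcl (φ.comp ⟨e.symm, e.symm.continuous⟩)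
  refine ⟨ψ.comp ⟨Subtype.val, continuous_subtype_val⟩, ?_⟩
  ext a
  have h := DFunLike.congr_fun hψ (e a)
  simp only [ContinuousMap.restrict_apply, ContinuousMap.comp_apply, ContinuousMap.coe_mk,
    Homeomorph.symm_apply_apply] at h
  exact h

/-- If `φ` is a family of `n + 2` non-negative functions without common zero, then the sets
`{φ i = 0}` can be replaced by closed sets `C i` which cover the space, have no common point, and
agree with `{φ i = 0}` wherever some `φ j` vanishes. -/
theorem ExtDimLE.exists_closed_cover {Z : Type u} [TopologicalSpace Z] {n : ℕ}
    (hZ : ExtDimLE Z (StdSphere n)) (φ : Fin (n + 2) → Z → ℝ) (hc : ∀ i, Continuous (φ i))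
    (h0 : ∀ i z, 0 ≤ φ i z) (hpos : ∀ z, ∃ i, 0 < φ i z) :
    ∃ C : Fin (n + 2) → Set Z, (∀ i, IsClosed (C i)) ∧ (∀ z, ∃ i, z ∈ C i) ∧
      (∀ z, ∃ i, z ∉ C i) ∧ ∀ z, (∃ j, φ j z = 0) → ∀ i, (z ∈ C i ↔ φ i z = 0) := by
  let B : Set Z := {z | ∃ i, φ i z = 0}
  have hB : IsClosed B := by
    have : B = ⋃ i, {z | φ i z = 0} := by ext; simp [B]
    rw [this]
    exact isClosed_iUnion_of_finite fun i => isClosed_eq (hc i) continuous_const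
  -- `y` is the class of `φ` in `ℝ^(n+2)` modulo the diagonal. It vanishes only where all `φ i` are
  -- equal, hence positive, which excludes `B`.
  let y : Z → EuclideanSpace ℝ (Fin (n + 1)) := fun z =>
    WithLp.toLp 2 fun i => φ i.castSucc z - φ (Fin.last _) z
  have hy : Continuous y := by fun_prop
  have hyB : ∀ z ∈ B, y z ≠ 0 := by
    rintro z ⟨j, hj⟩ h
    have h1 : ∀ i : Fin (n + 1), φ i.castSucc z = φ (Fin.last _) z := fun i => by
      have := congrArg (fun v : EuclideanSpace ℝ (Fin (n + 1)) => v i) h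
      simpa [y, sub_eq_zero] using this
    have h2 : ∀ i, φ i z = φ (Fin.last _) z := fun i => by
      induction i using Fin.lastCases with
      | last => rfl
      | cast i => exact h1 i
    obtain ⟨i, hi⟩ := hpos z
    rw [h2 i, ← h2 j, hj] at hi
    exact lt_irrefl _ hi
  obtain ⟨Ψ, hΨ⟩ := hZ B hB
    ⟨fun z => ⟨‖y z‖⁻¹ • y z, by
      have : ‖y z‖ ≠ 0 := norm_ne_zero_iff.2 (hyB z z.2)
      simp [norm_smul, this]⟩, by
      have hyr : Continuous fun z : B => y z := hy.comp continuous_subtype_val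
      exact (((hyr.norm.inv₀ fun z => norm_ne_zero_iff.2 (hyB z z.2)).smul hyr).subtype_mk _)⟩
  have hΨB : ∀ z ∈ B, ((Ψ z : StdSphere n) : EuclideanSpace ℝ (Fin (n + 1))) = ‖y z‖⁻¹ • y z :=
    fun z hz => congrArg Subtype.val (DFunLike.congr_fun hΨ ⟨z, hz⟩)
  let t : Fin (n + 2) → Z → ℝ := fun i z =>
    Fin.lastCases (motive := fun _ => ℝ) 0 (fun k => (Ψ z : EuclideanSpace ℝ (Fin (n + 1))) k) i
  have ht : ∀ i, Continuous (t i) := fun i => by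
    induction i using Fin.lastCases with
    | last => simpa [t] using continuous_const
    | cast i =>
      simp only [t, Fin.lastCases_castSucc]
      fun_prop
  have htB : ∀ z ∈ B, ∀ i, t i z = ‖y z‖⁻¹ * (φ i z - φ (Fin.last _) z) := fun z hz i => by
    induction i using Fin.lastCases with
    | last => simp [t]
    | cast i => simp [t, hΨB z hz, y]
  -- `C i` is where `t i` is minimal. On `B`, `t` is a positive multiple of `φ` up to adding a
  -- common term, and the minimum of the `φ j` is `0`. All `t i` agreeing would force `Ψ z = 0`.
  refine ⟨fun i => {z | ∀ j, t i z ≤ t j z}, fun i => ?_, fun z => ?_, fun z => ?_, ?_⟩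
  · simp only [ofPred_forall]
    exact isClosed_iInter fun j => isClosed_le (ht i) (ht j)
  · obtain ⟨i, hi⟩ := Finite.exists_min fun i => t i z
    exact ⟨i, hi⟩
  · by_contra! h
    have h1 : ∀ i, t i z = 0 := fun i => by
      have h2 : t (Fin.last _) z = 0 := by simp [t]
      rw [← h2]
      exact le_antisymm (h i _) (h _ i)
    have h3 : (Ψ z : EuclideanSpace ℝ (Fin (n + 1))) = 0 := by
      ext i
      simpa [t] using h1 i.castSucc
    have h4 : ‖(Ψ z : EuclideanSpace ℝ (Fin (n + 1)))‖ = 1 := by simp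
    rw [h3, norm_zero] at h4
    exact zero_ne_one h4
  · rintro z ⟨j, hj⟩ i
    have hz : z ∈ B := ⟨j, hj⟩
    have hpos' : 0 < ‖y z‖⁻¹ := inv_pos.2 (norm_pos_iff.2 (hyB z hz))
    simp only [mem_ofPred_eq, htB z hz, mul_le_mul_iff_right₀ hpos', sub_le_sub_iff_right]
    refine ⟨fun h => le_antisymm (hj ▸ h j) (h0 i z), fun h k => h ▸ h0 k z⟩

/-- The members outside `σ` stay untouched, so only the closed set `D` missed by their shrinkings
matters. There the sphere condition gives closed sets covering `D` without a common point; cutting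
them out of the members of `σ` destroys the common intersection on `D` but still leaves `D` covered.
Cutting only inside `closure T` is what lets infinitely many steps be iterated. -/
theorem ExtDimLE.exists_shrink_step {Z : Type u} [TopologicalSpace Z] [NormalSpace Z] {n : ℕ}
    (hZ : ExtDimLE Z (StdSphere n)) {v : ℕ → Set Z} (hvo : ∀ i, IsOpen (v i))
    (hvf : LocallyFinite v) (hvc : ⋃ i, v i = univ) {σ : Finset ℕ} (hσ : σ.card = n + 2) :
    ∃ v' : ℕ → Set Z, (∀ i, IsOpen (v' i)) ∧ ⋃ i, v' i = univ ∧ (∀ i, v' i ⊆ v i) ∧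
      ⋂ i ∈ σ, v' i = ∅ ∧ ∀ z ∉ closure (⋂ i ∈ σ, v i), ∀ i, z ∈ v i → z ∈ v' i := by
  classical
  obtain ⟨w, hwc, hwo, hwv⟩ := exists_iUnion_eq_closure_subset hvo hvf.point_finite hvc
  have hwf : LocallyFinite w := hvf.subset fun i => subset_closure.trans (hwv i)
  set D : Set Z := (⋃ i : {i // i ∉ σ}, w i)ᶜ with hDdef
  have hD : IsClosed D := (isOpen_iUnion fun i : {i // i ∉ σ} => hwo i).isClosed_compl
  have hDw : ∀ z ∈ D, ∃ i ∈ σ, z ∈ w i := fun z hz => by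
    obtain ⟨i, hi⟩ := mem_iUnion.1 (hwc.ge (mem_univ z))
    refine ⟨i, ?_, hi⟩
    by_contra h
    exact hz (mem_iUnion.2 ⟨⟨i, h⟩, hi⟩)
  have hDint : ∀ z, (∀ i, i ∉ σ → z ∉ v i) → z ∈ interior D := fun z hz => by
    have h := (hwf.comp_injective (Subtype.val_injective (p := fun i => i ∉ σ))).closure_iUnion
    simp only [Function.comp_apply] at h
    rw [hDdef, interior_compl, mem_compl_iff, h, mem_iUnion]
    rintro ⟨i, hi⟩
    exact hz i i.2 (hwv i hi)
  have hur : ∀ i, ∃ f : C(Z, ℝ), EqOn f 0 (v i)ᶜ ∧ EqOn f 1 (closure (w i)) ∧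
      ∀ x, f x ∈ Icc (0 : ℝ) 1 := fun i =>
    exists_continuous_zero_one_of_isClosed (hvo i).isClosed_compl isClosed_closure
      (disjoint_compl_left_iff_subset.2 (hwv i))
  choose f hf0 hf1 hf using hur
  let e : Fin (n + 2) ≃ σ := (σ.equivFinOfCardEq hσ).symm
  obtain ⟨C, hCc, hCcov, hCint, hC⟩ := (hZ.of_isClosed hD).exists_closed_cover
    (fun k z => f (e k) z) (fun k => by fun_prop) (fun k z => (hf _ _).1) (fun z => by
      obtain ⟨i, hi, hzi⟩ := hDw z z.2
      refine ⟨e.symm ⟨i, hi⟩, ?_⟩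
      simp [hf1 i (subset_closure hzi)])
  let C' : σ → Set Z := fun i => Subtype.val '' C (e.symm i)
  have hC'c : ∀ i, IsClosed (C' i) := fun i => hD.isClosedEmbedding_subtypeVal.isClosedMap _ (hCc _)
  set T : Set Z := ⋂ i ∈ σ, v i with hT
  let a : ℕ → Set Z := fun i => if h : i ∈ σ then v i \ (closure T ∩ C' ⟨i, h⟩) else v i
  have hao : ∀ i, IsOpen (a i) := fun i => by
    by_cases h : i ∈ σ
    · simp only [a, h, dif_pos]
      exact (hvo i).sdiff (isClosed_closure.inter (hC'c _))
    · simpa [a, h] using hvo i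
  have hav : ∀ i, a i ⊆ v i := fun i => by
    by_cases h : i ∈ σ
    · simp only [a, h, dif_pos]
      exact sdiff_subset
    · simp [a, h]
  have hcov : ∀ z ∈ D, ∃ i ∈ σ, z ∈ a i := by
    intro z hz
    by_cases hzT : z ∈ closure T
    -- A point outside `C k` lies in `v (e k)`, since where `f (e k)` vanishes `C k` agrees with its
    -- zero set.
    · obtain ⟨k, hk⟩ := hCint ⟨z, hz⟩
      refine ⟨e k, (e k).2, ?_⟩
      have hzv : z ∈ v (e k) := by
        by_contra hzv
        have h1 : f (e k) z = 0 := hf0 (e k) hzv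
        exact hk ((hC ⟨z, hz⟩ ⟨k, h1⟩ k).2 h1)
      simp only [a, (e k).2, dif_pos]
      refine ⟨hzv, ?_⟩
      rintro ⟨-, x, hx, hxz⟩
      obtain rfl : x = ⟨z, hz⟩ := Subtype.ext hxz
      simp only [Subtype.coe_eta, Equiv.symm_apply_apply] at hx
      exact hk hx
    · obtain ⟨i, hi, hzi⟩ := hDw z hz
      refine ⟨i, hi, ?_⟩
      simp only [a, hi, dif_pos]
      exact ⟨hwv i (subset_closure hzi), fun h => hzT h.1⟩
  set T' : Set Z := ⋂ i ∈ σ, a i with hT'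
  have hT'T : T' ⊆ T := iInter₂_mono fun i _ => hav i
  have hT'D : ∀ z ∈ T', z ∉ D := fun z hz hzD => by
    obtain ⟨k, hk⟩ := hCcov ⟨z, hzD⟩
    have h1 : z ∈ a (e k) := mem_iInter₂.1 hz _ (e k).2
    simp only [a, (e k).2, dif_pos] at h1
    exact h1.2 ⟨subset_closure (hT'T hz), ⟨z, hzD⟩, by simpa using hk, rfl⟩
  -- `T'` avoids `D`, so `closure T'` avoids `interior D`. Points outside `interior D` lie in some
  -- untouched `v i` with `i ∉ σ`, so removing `closure T'` keeps a cover.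
  refine ⟨fun i => if i ∈ σ then a i \ closure T' else a i, fun i => ?_, ?_, fun i => ?_, ?_, ?_⟩
  · dsimp only
    split_ifs
    exacts [(hao i).sdiff isClosed_closure, hao i]
  · refine eq_univ_of_forall fun z => mem_iUnion.2 ?_
    by_cases hz : ∃ i, i ∉ σ ∧ z ∈ v i
    · obtain ⟨i, hi, hzi⟩ := hz
      exact ⟨i, by simpa [hi, a] using hzi⟩
    · push Not at hz
      have hzD := hDint z hz
      obtain ⟨i, hi, hzi⟩ := hcov z (interior_subset hzD)
      refine ⟨i, ?_⟩
      simp only [hi, if_true]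
      refine ⟨hzi, fun hzc => ?_⟩
      obtain ⟨x, hxD, hxT⟩ := mem_closure_iff.1 hzc _ isOpen_interior hzD
      exact hT'D x hxT (interior_subset hxD)
  · dsimp only
    split_ifs
    exacts [sdiff_subset.trans (hav i), hav i]
  · refine eq_empty_of_forall_notMem fun z hz => ?_
    have h1 : ∀ i ∈ σ, z ∈ a i \ closure T' := fun i hi => by
      simpa [hi] using mem_iInter₂.1 hz i hi
    have h2 : z ∈ T' := mem_iInter₂.2 fun i hi => (h1 i hi).1
    obtain ⟨i, hi⟩ : σ.Nonempty := Finset.card_pos.1 (by omega)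
    exact (h1 i hi).2 (subset_closure h2)
  · intro z hz i hzi
    have hza : z ∈ a i := by
      by_cases h : i ∈ σ
      · simp only [a, h, dif_pos]
        exact ⟨hzi, fun h => hz h.1⟩
      · simpa [a, h] using hzi
    dsimp only
    split_ifs
    exacts [⟨hza, fun h => hz (closure_mono hT'T h)⟩, hza]

/-- All finite index sets are treated one after another. Near a given point only finitely many of
them have all their members present, so the process stabilises locally and the limit is again an
open cover. -/
theorem ExtDimLE.exists_shrink_nat {Z : Type u} [TopologicalSpace Z] [NormalSpace Z] {n : ℕ}
    (hZ : ExtDimLE Z (StdSphere n)) {u : ℕ → Set Z} (huo : ∀ i, IsOpen (u i))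
    (huf : LocallyFinite u) (huc : ⋃ i, u i = univ) :
    ∃ w : ℕ → Set Z, (∀ i, IsOpen (w i)) ∧ ⋃ i, w i = univ ∧ (∀ i, w i ⊆ u i) ∧
      ∀ σ : Finset ℕ, σ.card = n + 2 → ⋂ i ∈ σ, w i = ∅ := by
  classical
  let S := {v : ℕ → Set Z // (∀ i, IsOpen (v i)) ∧ ⋃ i, v i = univ ∧ ∀ i, v i ⊆ u i}
  have hstep : ∀ (σ : Finset ℕ) (v : S), ∃ v' : S, (∀ i, v'.1 i ⊆ v.1 i) ∧
      (σ.card = n + 2 → ⋂ i ∈ σ, v'.1 i = ∅) ∧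
      ∀ z ∉ closure (⋂ i ∈ σ, u i), ∀ i, z ∈ v.1 i → z ∈ v'.1 i := by
    intro σ v
    by_cases hσ : σ.card = n + 2
    · obtain ⟨v', h1, h2, h3, h4, h5⟩ :=
        hZ.exists_shrink_step v.2.1 (huf.subset v.2.2.2) v.2.2.1 hσ
      exact ⟨⟨v', h1, h2, fun i => (h3 i).trans (v.2.2.2 i)⟩, h3, fun _ => h4, fun z hz i hi =>
        h5 z (fun h => hz (closure_mono (iInter₂_mono fun i _ => v.2.2.2 i) h)) i hi⟩
    · exact ⟨v, fun i => Subset.rfl, fun h => (hσ h).elim, fun z _ i hi => hi⟩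
  choose step hstep_sub hstep_inter hstep_eq using hstep
  let e : Finset ℕ ≃ ℕ := Denumerable.eqv (Finset ℕ)
  let V : ℕ → S := fun j => Nat.rec ⟨u, huo, huc, fun _ => Subset.rfl⟩
    (fun j v => step (e.symm j) v) j
  have hV : ∀ j, V (j + 1) = step (e.symm j) (V j) := fun j => rfl
  have hanti : ∀ i, Antitone fun j => (V j).1 i := fun i =>
    antitone_nat_of_succ_le fun j => by rw [hV]; exact hstep_sub _ _ i
  have hloc : ∀ z, ∃ N : Set Z, IsOpen N ∧ z ∈ N ∧ ∃ j₀, ∀ i, ∀ x ∈ N, x ∈ (V j₀).1 i →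
      ∀ j, x ∈ (V j).1 i := by
    intro z
    obtain ⟨N', hN', hfin⟩ := huf z
    obtain ⟨N, hNN', hNo, hzN⟩ := mem_nhds_iff.1 hN'
    -- `j₀` bounds the codes of the finitely many `σ` all of whose members meet `N'`; later steps
    -- change nothing on `N`.
    obtain ⟨j₀, hj₀⟩ := (hfin.toFinset.powerset.image e).bddAbove
    refine ⟨N, hNo, hzN, j₀ + 1, fun i x hx hxi j => ?_⟩
    have hup : ∀ k, x ∈ (V (j₀ + 1 + k)).1 i := by
      intro k
      induction k with
      | zero => exact hxi
      | succ k ih =>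
        rw [← add_assoc, hV]
        refine hstep_eq _ _ x (fun hcl => ?_) i ih
        obtain ⟨y, hyN, hy⟩ := mem_closure_iff.1 hcl N hNo hx
        have : e.symm (j₀ + 1 + k) ⊆ hfin.toFinset := fun a ha => by
          simpa using ⟨y, mem_iInter₂.1 hy a ha, hNN' hyN⟩
        have h2 := hj₀ (Finset.mem_coe.2 (Finset.mem_image_of_mem e (Finset.mem_powerset.2 this)))
        rw [Equiv.apply_symm_apply] at h2
        omega
    rcases le_total j (j₀ + 1) with h | h
    · exact hanti i h hxi
    · obtain ⟨k, rfl⟩ := Nat.exists_eq_add_of_le h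
      exact hup k
  refine ⟨fun i => ⋂ j, (V j).1 i, fun i => isOpen_iff_mem_nhds.2 fun z hz => ?_, ?_,
    fun i => iInter_subset (fun j => (V j).1 i) 0, fun σ hσ => ?_⟩
  · obtain ⟨N, hNo, hzN, j₀, h⟩ := hloc z
    filter_upwards [hNo.mem_nhds hzN, ((V j₀).2.1 i).mem_nhds (mem_iInter.1 hz j₀)] with x hx hx'
    exact mem_iInter.2 (h i x hx hx')
  · refine eq_univ_of_forall fun z => ?_
    obtain ⟨N, hNo, hzN, j₀, h⟩ := hloc z
    obtain ⟨i, hi⟩ := mem_iUnion.1 ((V j₀).2.2.1.ge (mem_univ z))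
    exact mem_iUnion.2 ⟨i, mem_iInter.2 (h i z hzN hi)⟩
  · rw [← subset_empty_iff, ← hstep_inter σ (V (e σ)) hσ]
    refine iInter₂_mono fun i _ => (iInter_subset _ (e σ + 1)).trans ?_
    rw [hV, Equiv.symm_apply_apply]

/-- For a paracompact space of extension dimension at most `[S^n]`, every open cover has a locally
finite closed refinement of order at most `n + 1`. -/
theorem ExtDimLE.exists_closed_refinement {Z : Type u} [TopologicalSpace Z] [T2Space Z]
    [ParacompactSpace Z] {n : ℕ} (hZ : ExtDimLE Z (StdSphere n)) {ι : Type w} {u : ι → Set Z}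
    (huo : ∀ i, IsOpen (u i)) (huc : ⋃ i, u i = univ) :
    ∃ (κ : Type w) (F : κ → Set Z), (∀ k, IsClosed (F k)) ∧ LocallyFinite F ∧ ⋃ k, F k = univ ∧
      (∀ k, ∃ i, F k ⊆ u i) ∧ ∀ σ : Finset κ, σ.card = n + 2 → ⋂ k ∈ σ, F k = ∅ := by
  classical
  obtain ⟨ρ, hρ⟩ := PartitionOfUnity.exists_isSubordinate isClosed_univ u huo huc.ge
  -- Open stars of the barycentric subdivision: the functions indexed by `s` strictly dominate all
  -- others. Stars of distinct `s` of equal cardinality are disjoint, so grouping by cardinality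
  -- reduces the problem to a countable cover.
  let V : Finset ι → Set Z := fun s =>
    {z | s.Nonempty ∧ ∀ a ∈ s, 0 < ρ a z ∧ ∀ b, b ∉ s → ρ b z < ρ a z}
  have hVfin : ∀ z, ∃ N ∈ 𝓝 z, ∃ J : Finset ι, (∀ x ∈ N, ∀ b, b ∉ J → ρ b x = 0) ∧
      ∀ s, (V s ∩ N).Nonempty → s ⊆ J := by
    intro z
    obtain ⟨N, hN, hfin⟩ := ρ.locallyFinite z
    have h0 : ∀ x ∈ N, ∀ b, b ∉ hfin.toFinset → ρ b x = 0 := fun x hx b hb => by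
      by_contra h
      exact hb (by simpa using ⟨x, h, hx⟩)
    refine ⟨N, hN, hfin.toFinset, h0, fun s ⟨x, hxs, hxN⟩ a ha => ?_⟩
    by_contra h
    exact (hxs.2 a ha).1.ne' (h0 x hxN a h)
  have hVo : ∀ s, IsOpen (V s) := by
    refine fun s => isOpen_iff_mem_nhds.2 fun z hz => ?_
    obtain ⟨N, hN, J, hJ, -⟩ := hVfin z
    have h1 : ∀ᶠ x in 𝓝 z, ∀ a ∈ s, 0 < ρ a x :=
      (Filter.eventually_all_finset s).2 fun a ha =>
        (ρ a).continuous.continuousAt.eventually_const_lt (hz.2 a ha).1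
    have h2 : ∀ᶠ x in 𝓝 z, ∀ a ∈ s, ∀ b ∈ J \ s, ρ b x < ρ a x :=
      (Filter.eventually_all_finset s).2 fun a ha =>
        (Filter.eventually_all_finset (J \ s)).2 fun b hb =>
          (ρ b).continuous.continuousAt.eventually_lt (ρ a).continuous.continuousAt
            ((hz.2 a ha).2 b (Finset.mem_sdiff.1 hb).2)
    filter_upwards [hN, h1, h2] with x hxN hx1 hx2
    refine ⟨hz.1, fun a ha => ⟨hx1 a ha, fun b hb => ?_⟩⟩
    by_cases hbJ : b ∈ J
    · exact hx2 a ha b (Finset.mem_sdiff.2 ⟨hbJ, hb⟩)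
    · rw [hJ x hxN b hbJ]
      exact hx1 a ha
  have hVdisj : ∀ s t, s.card = t.card → ∀ z, z ∈ V s → z ∈ V t → s = t := by
    intro s t hst z hs ht
    by_contra hne
    have h1 : ¬ s ⊆ t := fun h => hne (Finset.eq_of_subset_of_card_le h hst.ge)
    have h2 : ¬ t ⊆ s := fun h => hne (Finset.eq_of_subset_of_card_le h hst.le).symm
    obtain ⟨a, has, hat⟩ := Finset.not_subset.1 h1
    obtain ⟨b, hbt, hbs⟩ := Finset.not_subset.1 h2
    exact lt_asymm ((hs.2 a has).2 b hbs) ((ht.2 b hbt).2 a hat)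
  have hVcov : ∀ z, ∃ s, z ∈ V s := by
    intro z
    obtain ⟨N, hN, J, hJ, -⟩ := hVfin z
    obtain ⟨i, hi⟩ := ρ.exists_pos (mem_univ z)
    have hiJ : i ∈ J := by
      by_contra h
      exact hi.ne' (hJ z (mem_of_mem_nhds hN) i h)
    obtain ⟨a, haJ, ha⟩ := J.exists_max_image (fun a => ρ a z) ⟨i, hiJ⟩
    have hapos : 0 < ρ a z := hi.trans_le (ha i hiJ)
    refine ⟨J.filter fun b => ρ b z = ρ a z, ⟨a, by simp [haJ]⟩, fun b hb => ?_⟩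
    rw [(Finset.mem_filter.1 hb).2]
    refine ⟨hapos, fun c hc => ?_⟩
    by_cases hcJ : c ∈ J
    · exact lt_of_le_of_ne (ha c hcJ) fun h => hc (Finset.mem_filter.2 ⟨hcJ, h⟩)
    · rwa [hJ z (mem_of_mem_nhds hN) c hcJ]
  let W : ℕ → Set Z := fun k => ⋃ s : {s : Finset ι // s.card = k}, V s
  have hWo : ∀ k, IsOpen (W k) := fun k =>
    isOpen_iUnion fun s : {s : Finset ι // s.card = k} => hVo s
  have hWf : LocallyFinite W := by
    intro z
    obtain ⟨N, hN, J, -, hJ⟩ := hVfin z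
    refine ⟨N, hN, (finite_Iic J.card).subset ?_⟩
    rintro k ⟨x, hxW, hxN⟩
    obtain ⟨⟨s, rfl⟩, hs⟩ := mem_iUnion.1 hxW
    exact Finset.card_le_card (hJ s ⟨x, hs, hxN⟩)
  have hWc : ⋃ k, W k = univ := eq_univ_of_forall fun z => by
    obtain ⟨s, hs⟩ := hVcov z
    exact mem_iUnion.2 ⟨s.card, mem_iUnion.2 ⟨⟨s, rfl⟩, hs⟩⟩
  obtain ⟨w, hwo, hwc, hwW, hwσ⟩ := hZ.exists_shrink_nat hWo hWf hWc
  obtain ⟨E, hEc, hEcl, hEw⟩ :=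
    exists_iUnion_eq_closed_subset hwo (hWf.subset hwW).point_finite hwc
  refine ⟨{s : Finset ι // s.Nonempty}, fun s => E s.1.card ∩ V s, fun s => ?_, fun z => ?_, ?_,
    fun s => ?_, fun σ hσ => ?_⟩
  -- Inside `W k` the stars form a disjoint open family, so each is relatively closed there.
  · have : E s.1.card ∩ V s =
        E s.1.card \ ⋃ t : {t : Finset ι // t.card = s.1.card ∧ t ≠ s.1}, V t := by
      ext z
      refine and_congr_right fun hz => ⟨fun hs ht => ?_, fun h => ?_⟩
      · obtain ⟨⟨t, htc, hts⟩, ht⟩ := mem_iUnion.1 ht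
        exact hts (hVdisj t s htc z ht hs)
      · obtain ⟨⟨t, htc⟩, ht⟩ := mem_iUnion.1 (hwW _ (hEw _ hz))
        by_cases hts : t = s.1
        · exact hts ▸ ht
        · exact (h (mem_iUnion.2 ⟨⟨t, htc, hts⟩, ht⟩)).elim
    dsimp only
    rw [this]
    exact (hEcl _).sdiff (isOpen_iUnion fun t => hVo _)
  · obtain ⟨N, hN, J, -, hJ⟩ := hVfin z
    refine ⟨N, hN, Finite.of_finite_image (f := Subtype.val) ?_ Subtype.val_injective.injOn⟩
    refine (J.powerset.finite_toSet).subset ?_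
    rintro _ ⟨s, ⟨x, hx, hxN⟩, rfl⟩
    exact Finset.mem_coe.2 (Finset.mem_powerset.2 (hJ s ⟨x, hx.2, hxN⟩))
  · refine eq_univ_of_forall fun z => ?_
    obtain ⟨k, hk⟩ := mem_iUnion.1 (hEc.ge (mem_univ z))
    obtain ⟨⟨s, rfl⟩, hs⟩ := mem_iUnion.1 (hwW _ (hEw _ hk))
    exact mem_iUnion.2 ⟨⟨s, hs.1⟩, hk, hs⟩
  · obtain ⟨a, ha⟩ := s.2
    exact ⟨a, fun z hz => hρ a (subset_tsupport _ (hz.2.2 a ha).1.ne')⟩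
  · refine eq_empty_of_forall_notMem fun z hz => ?_
    have hz' : ∀ s ∈ σ, z ∈ E s.1.card ∧ z ∈ V s := fun s hs => mem_iInter₂.1 hz s hs
    -- Stars sharing a point have different cardinalities, so the order is bounded by that of the
    -- cover `w`.
    have hinj : Set.InjOn (fun s : {s : Finset ι // s.Nonempty} => s.1.card) σ :=
      fun s hs t ht hst => Subtype.ext (hVdisj s t hst z (hz' s hs).2 (hz' t ht).2)
    have h := hwσ (σ.image fun s => s.1.card) (by rw [Finset.card_image_of_injOn hinj, hσ])
    refine eq_empty_iff_forall_notMem.1 h z (mem_iInter₂.2 fun k hk => ?_)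
    obtain ⟨s, hs, rfl⟩ := Finset.mem_image.1 hk
    exact hEw _ (hz' s hs).1

/-! ### Extension over the intersections of a closed cover -/

/-- Extension along the skeleta of a closed cover `F` of order at most `n + 1`: the map is
constructed on the `m`-fold intersections of the cover for `m = n + 1, n, …, 1`. -/
theorem exists_continuous_of_closed_cover {Z : Type u} {Y : Type v} [TopologicalSpace Z]
    [TopologicalSpace Y] [Nonempty Y] {κ : Type w} {F : κ → Set Z} {n : ℕ}
    (hFc : ∀ k, IsClosed (F k)) (hFf : LocallyFinite F) (hFu : ⋃ k, F k = univ)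
    (hFn : ∀ σ : Finset κ, σ.card = n + 2 → ⋂ k ∈ σ, F k = ∅) (U V : Finset κ → Set Y)
    (hext : ∀ σ : Finset κ, σ.Nonempty → σ.card ≤ n + 1 → ∀ A ⊆ ⋂ k ∈ σ, F k, IsClosed A →
      ∀ h : Z → Y, ContinuousOn h A → MapsTo h A (V σ) →
        ∃ h' : Z → Y, ContinuousOn h' (⋂ k ∈ σ, F k) ∧ MapsTo h' (⋂ k ∈ σ, F k) (U σ) ∧
          EqOn h' h A)
    (hUV : ∀ σ τ : Finset κ, σ.Nonempty → σ ⊆ τ → τ.card = σ.card + 1 → τ.card ≤ n + 1 →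
      (⋂ k ∈ τ, F k).Nonempty → U τ ⊆ V σ) :
    ∃ h : Z → Y, Continuous h ∧ ∀ k, MapsTo h (F k) (U {k}) := by
  classical
  let I : Finset κ → Set Z := fun σ => ⋂ k ∈ σ, F k
  have hIc : ∀ σ, IsClosed (I σ) := fun σ => isClosed_biInter fun k _ => hFc k
  let S : ℕ → Set Z := fun m => ⋃ σ : {σ : Finset κ // σ.card = m}, I σ
  have hlf : ∀ m, 1 ≤ m → LocallyFinite fun σ : {σ : Finset κ // σ.card = m} => I σ := by
    intro m hm z
    obtain ⟨N, hN, hfin⟩ := hFf z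
    refine ⟨N, hN, Finite.of_finite_image (f := Subtype.val) ?_ Subtype.val_injective.injOn⟩
    refine hfin.toFinset.powerset.finite_toSet.subset ?_
    rintro _ ⟨σ, ⟨x, hx, hxN⟩, rfl⟩
    refine Finset.mem_coe.2 (Finset.mem_powerset.2 fun k hk => ?_)
    simpa using ⟨x, mem_iInter₂.1 hx k hk, hxN⟩
  have hSc : ∀ m, 1 ≤ m → IsClosed (S m) := fun m hm =>
    (hlf m hm).isClosed_iUnion fun σ => hIc σ
  have claim : ∀ d m, m + d = n + 2 → 1 ≤ m → ∃ h : Z → Y, ContinuousOn h (S m) ∧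
      ∀ σ : Finset κ, σ.card = m → MapsTo h (I σ) (U σ) := by
    intro d
    induction d with
    | zero =>
      intro m hm _
      have hI : ∀ σ : Finset κ, σ.card = m → I σ = ∅ := fun σ hσ => hFn σ (by omega)
      have hS : S m = ∅ := by
        simp only [S, iUnion_eq_empty]
        exact fun σ => hI σ σ.2
      refine ⟨fun _ => Classical.arbitrary Y, continuousOn_const, fun σ hσ => ?_⟩
      rw [hI σ hσ]
      exact mapsTo_empty _ _
    | succ d ih =>
      intro m hm hm1
      obtain ⟨h, hcont, hmaps⟩ := ih (m + 1) (by omega) (by omega)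
      -- A point of `I σ` in any `(m + 1)`-fold intersection also lies in one of the form `I (insert
      -- k σ)`, where `hUV` compares the two levels.
      have hV : ∀ σ : Finset κ, σ.card = m → MapsTo h (I σ ∩ S (m + 1)) (V σ) := by
        rintro σ hσ z ⟨hzσ, hzS⟩
        obtain ⟨⟨τ, hτ⟩, hzτ⟩ := mem_iUnion.1 hzS
        obtain ⟨k, hkτ, hkσ⟩ : ∃ k ∈ τ, k ∉ σ := by
          by_contra! hsub
          have := Finset.card_le_card (show τ ⊆ σ from hsub)
          omega
        have hzk : z ∈ I (insert k σ) := mem_iInter₂.2 fun a ha => by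
          rcases Finset.mem_insert.1 ha with rfl | ha
          exacts [mem_iInter₂.1 hzτ _ hkτ, mem_iInter₂.1 hzσ a ha]
        have hcard : (insert k σ).card = m + 1 := by rw [Finset.card_insert_of_notMem hkσ, hσ]
        have hle : m + 1 ≤ n + 1 := by
          by_contra hlt
          exact (hFn (insert k σ) (by omega)).le hzk
        exact hUV σ (insert k σ) (Finset.card_pos.1 (by omega)) (Finset.subset_insert _ _)
          (by omega) (by omega) ⟨z, hzk⟩ (hmaps _ hcard hzk)
      have hex : ∀ σ : {σ : Finset κ // σ.card = m}, ∃ h' : Z → Y, ContinuousOn h' (I σ) ∧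
          MapsTo h' (I σ) (U σ) ∧ EqOn h' h (I σ ∩ S (m + 1)) := fun σ =>
        hext σ (Finset.card_pos.1 (by have := σ.2; omega)) (by have := σ.2; omega) _
          inter_subset_left ((hIc σ).inter (hSc _ (by omega))) h (hcont.mono inter_subset_right)
          (hV σ σ.2)
      choose h' hc' hU' hE' using hex
      -- The chosen index is harmless: distinct `m`-fold intersections meet only inside `S (m + 1)`,
      -- where every `h' σ` equals `h`.
      let H : Z → Y := fun z => if hz : z ∈ S m \ S (m + 1) then
        h' (mem_iUnion.1 hz.1).choose z else h z
      have hH : ∀ σ : {σ : Finset κ // σ.card = m}, EqOn H (h' σ) (I σ) := by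
        intro σ z hz
        by_cases hzS : z ∈ S (m + 1)
        · have h1 : H z = h z := dif_neg fun h => h.2 hzS
          rw [h1, hE' σ ⟨hz, hzS⟩]
        · have hz' : z ∈ S m \ S (m + 1) := ⟨mem_iUnion.2 ⟨σ, hz⟩, hzS⟩
          have h1 : H z = h' (mem_iUnion.1 hz'.1).choose z := dif_pos hz'
          have h2 := (mem_iUnion.1 hz'.1).choose_spec
          set τ := (mem_iUnion.1 hz'.1).choose
          suffices τ = σ by rw [h1, this]
          by_contra hne
          obtain ⟨k, hkτ, hkσ⟩ : ∃ k ∈ τ.1, k ∉ σ.1 := by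
            by_contra! hsub
            exact hne (Subtype.ext (Finset.eq_of_subset_of_card_le hsub (by rw [σ.2, τ.2])))
          refine hzS (mem_iUnion.2 ⟨⟨insert k σ.1, by
            rw [Finset.card_insert_of_notMem hkσ, σ.2]⟩, mem_iInter₂.2 fun a ha => ?_⟩)
          rcases Finset.mem_insert.1 ha with rfl | ha
          exacts [mem_iInter₂.1 h2 _ hkτ, mem_iInter₂.1 hz a ha]
      refine ⟨H, (hlf m hm1).continuousOn_iUnion (fun σ => hIc σ) fun σ => (hc' σ).congr (hH σ),
        fun σ hσ z hz => ?_⟩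
      rw [hH ⟨σ, hσ⟩ hz]
      exact hU' ⟨σ, hσ⟩ hz
  obtain ⟨h, hcont, hmaps⟩ := claim (n + 1) 1 (by omega) le_rfl
  refine ⟨h, ?_, fun k z hz => hmaps {k} rfl (by simpa [I] using hz)⟩
  have hS : S 1 = univ := eq_univ_of_forall fun z => by
    obtain ⟨k, hk⟩ := mem_iUnion.1 (hFu.ge (mem_univ z))
    exact mem_iUnion.2 ⟨⟨{k}, rfl⟩, by simpa [I] using hk⟩
  rwa [hS, continuousOn_univ] at hcont

theorem IsLConnectedPair.exists_extension {L : Type v} [TopologicalSpace L] {Y Z : Type u}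
    [TopologicalSpace Y] [TopologicalSpace Z] [T2Space Z] [ParacompactSpace Z] {V U : Set Y}
    (hVU : IsLConnectedPair L V U) (hZ : ExtDimLE Z L) {F A : Set Z} (hF : IsClosed F)
    (hA : IsClosed A) (hAF : A ⊆ F) {h : Z → Y} (hh : ContinuousOn h A) (hV : MapsTo h A V) :
    ∃ h' : Z → Y, ContinuousOn h' F ∧ MapsTo h' F U ∧ EqOn h' h A := by
  classical
  have := hF.isClosedEmbedding_subtypeVal.paracompactSpace
  obtain ⟨ψ, hψU, hψ⟩ := hVU.2 F (hZ.of_isClosed hF) (Subtype.val ⁻¹' A)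
    (hA.preimage continuous_subtype_val)
    ⟨fun a => h a.1.1, hh.comp_continuous (by fun_prop) fun a => a.2⟩ (fun a => hV a.2)
  refine ⟨fun z => if hz : z ∈ F then ψ ⟨z, hz⟩ else h z, ?_, fun z hz => ?_, fun z hz => ?_⟩
  · rw [continuousOn_iff_continuous_domRestrict]
    refine ψ.continuous.congr fun z => ?_
    simp [domRestrict]
  · simp only [hz, dif_pos]
    exact hψU _
  · simp only [hAF hz, dif_pos]
    exact DFunLike.congr_fun hψ ⟨⟨z, hAF hz⟩, hz⟩

/-- Serves the deepest intersections, where there is nothing to extend and a constant map suffices.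
-/
theorem IsLConnectedPair.empty_left (L : Type v) [TopologicalSpace L] {Y : Type u}
    [TopologicalSpace Y] {U : Set Y} (hU : U.Nonempty) : IsLConnectedPair L ∅ U := by
  refine ⟨empty_subset U, fun Z _ _ _ _ A _ φ hφ => ?_⟩
  obtain ⟨y, hy⟩ := hU
  exact ⟨ContinuousMap.const Z y, fun _ => hy, ContinuousMap.ext fun a => (hφ a).elim⟩

/-! ### Neighbourhood systems of graphs -/

/-- Take a locally finite refinement `v` and a shrinking `w` with `closure (w k) ⊆ v k`. A small `P`
around `y` lies in `v k` if `y ∈ closure (w k)`, and misses `w k` otherwise. -/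
theorem exists_open_refinement_iUnion {M : Type u} [MetricSpace M] {κ : Type w} {O : κ → Set M}
    (hO : ∀ k, IsOpen (O k)) :
    ∃ Q : κ → Set M, (∀ k, IsOpen (Q k)) ∧ (∀ k, Q k ⊆ O k) ∧ ⋃ k, Q k = ⋃ k, O k ∧
      ∀ y ∈ ⋃ k, O k, ∃ P : Set M, IsOpen P ∧ y ∈ P ∧ {k | (Q k ∩ P).Nonempty}.Finite ∧
        ∀ k, (Q k ∩ P).Nonempty → P ⊆ O k := by
  have hOo : IsOpen (⋃ k, O k) := isOpen_iUnion hO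
  have hemb := hOo.isOpenEmbedding_subtypeVal
  obtain ⟨v, hvo, hvc, hvf, hvO⟩ := precise_refinement
    (fun k => (Subtype.val ⁻¹' O k : Set (⋃ k, O k)))
    (fun k => (hO k).preimage continuous_subtype_val)
    (by rw [← preimage_iUnion, Subtype.coe_preimage_self])
  obtain ⟨w, hwc, hwo, hwv⟩ := exists_iUnion_eq_closure_subset hvo hvf.point_finite hvc
  refine ⟨fun k => Subtype.val '' w k, fun k => hemb.isOpenMap _ (hwo k), fun k => ?_, ?_, ?_⟩
  · rintro _ ⟨z, hz, rfl⟩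
    exact hvO k (hwv k (subset_closure hz))
  · rw [← image_iUnion, hwc, image_univ, Subtype.range_coe]
  · intro y hy
    obtain ⟨N, hN, hfin⟩ := hvf ⟨y, hy⟩
    have hev : ∀ᶠ x in 𝓝 (⟨y, hy⟩ : (⋃ k, O k : Set M)), ∀ k ∈ {k | (v k ∩ N).Nonempty},
        (⟨y, hy⟩ ∈ closure (w k) → x ∈ v k) ∧ (⟨y, hy⟩ ∉ closure (w k) → x ∉ closure (w k)) := by
      refine (Filter.eventually_all_finite hfin).2 fun k _ => ?_
      by_cases h : ⟨y, hy⟩ ∈ closure (w k)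
      · filter_upwards [(hvo k).mem_nhds (hwv k h)] with x hx
        exact ⟨fun _ => hx, fun h' => (h' h).elim⟩
      · filter_upwards [isClosed_closure.isOpen_compl.mem_nhds h] with x hx
        exact ⟨fun h' => (h h').elim, fun _ => hx⟩
    obtain ⟨P, hPsub, hPo, hyP⟩ := mem_nhds_iff.1 (Filter.inter_mem hN hev)
    have hmeet : ∀ k, (Subtype.val '' w k ∩ Subtype.val '' P).Nonempty → ∃ x, x ∈ w k ∧ x ∈ P := by
      rintro k ⟨_, ⟨x, hx, rfl⟩, ⟨x', hx', hxx'⟩⟩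
      exact ⟨x, hx, Subtype.ext hxx' ▸ hx'⟩
    have hvN : ∀ k, ∀ x ∈ w k, x ∈ P → (v k ∩ N).Nonempty := fun k x hx hxP =>
      ⟨x, hwv k (subset_closure hx), (hPsub hxP).1⟩
    refine ⟨Subtype.val '' P, hemb.isOpenMap _ hPo, ⟨_, hyP, rfl⟩, hfin.subset fun k hk => ?_,
      fun k hk => ?_⟩
    · obtain ⟨x, hx, hxP⟩ := hmeet k hk
      exact hvN k x hx hxP
    · obtain ⟨x, hx, hxP⟩ := hmeet k hk
      have hkN := hvN k x hx hxP
      have hyk : ⟨y, hy⟩ ∈ closure (w k) := by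
        by_contra h
        exact ((hPsub hxP).2 k hkN).2 h (subset_closure hx)
      rintro _ ⟨x', hx', rfl⟩
      exact hvO k (((hPsub hx').2 k hkN).1 hyk)

/-- The pairs `(P x, U x)` form a neighbourhood system of the graph of `K` over `e : X → M`. -/
structure IsGraphCover {M X Y : Type*} [TopologicalSpace M] [TopologicalSpace Y] (e : X → M)
    (K : X → Set Y) (P : X → Set M) (U : X → Set Y) : Prop where
  isOpen : ∀ x, IsOpen (P x)
  mem : ∀ x, e x ∈ P x
  mem_nhdsSet : ∀ x x', e x' ∈ P x → U x ∈ 𝓝ˢ (K x')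

theorem UpperHemicontinuous.exists_isOpen {M X Y : Type*} [TopologicalSpace M] [TopologicalSpace X]
    [TopologicalSpace Y] {e : X → M} (he : IsInducing e) {K : X → Set Y}
    (hK : UpperHemicontinuous K) {x : X} {V : Set Y} (hV : V ∈ 𝓝ˢ (K x)) {P : Set M}
    (hP : P ∈ 𝓝 (e x)) :
    ∃ O ⊆ P, IsOpen O ∧ e x ∈ O ∧ ∀ x', e x' ∈ O → V ∈ 𝓝ˢ (K x') := by
  have h := upperHemicontinuous_iff.1 hK x
  have h := upperHemicontinuousAt_iff.1 h V hV
  rw [he.nhds_eq_comap, Filter.eventually_comap] at h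
  obtain ⟨O, hO, hOo, hxO⟩ := mem_nhds_iff.1 (Filter.inter_mem h hP)
  exact ⟨O, fun m hm => (hO hm).2, hOo, hxO, fun x' hx' => (hO hx').1 x' rfl⟩

/-- `U' y` is the intersection of the finitely many `V x` with `Q x` meeting `P' y`. For these, `P'
y` lies in the set over which `V x` remains a neighbourhood of the values of `K`. -/
theorem UpperHemicontinuous.exists_isGraphCover {M : Type u} [MetricSpace M] {X Y : Type*}
    [TopologicalSpace X] [TopologicalSpace Y] {e : X → M} (he : IsInducing e) {K : X → Set Y}
    (hK : UpperHemicontinuous K) {P : X → Set M} (hPo : ∀ x, IsOpen (P x)) (hP : ∀ x, e x ∈ P x)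
    {V : X → Set Y} (hV : ∀ x, V x ∈ 𝓝ˢ (K x)) :
    ∃ (Q P' : X → Set M) (U' : X → Set Y), (∀ x, IsOpen (Q x)) ∧ (∀ x, Q x ⊆ P x) ∧
      range e ⊆ ⋃ x, Q x ∧ IsGraphCover e K P' U' ∧
      ∀ x y, (Q x ∩ P' y).Nonempty → U' y ⊆ V x := by
  choose O hOP hOo hxO hOV using fun x => hK.exists_isOpen he (hV x) ((hPo x).mem_nhds (hP x))
  obtain ⟨Q, hQo, hQO, hQc, hloc⟩ := exists_open_refinement_iUnion hOo
  choose P' hP'o hP' hfin hP'O using fun x => hloc (e x) (mem_iUnion.2 ⟨x, hxO x⟩)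
  refine ⟨Q, P', fun y => ⋂ x ∈ {x | (Q x ∩ P' y).Nonempty}, V x, hQo,
    fun x => (hQO x).trans (hOP x), ?_, ⟨hP'o, hP', fun y x' hx' => ?_⟩, fun x y hxy => ?_⟩
  · rintro _ ⟨x, rfl⟩
    exact hQc.ge (mem_iUnion.2 ⟨x, hxO x⟩)
  · exact (Filter.biInter_mem (hfin y)).2 fun x hx => hOV x x' (hP'O y x hx hx')
  · exact biInter_subset_of_mem (show x ∈ {x | (Q x ∩ P' y).Nonempty} from hxy)

/-- The nested neighbourhood systems of the members of a filtration `H n ⊆ ⋯ ⊆ H 0`. -/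
theorem exists_nested_isGraphCover (L : Type v) [TopologicalSpace L] {M X Y : Type u}
    [MetricSpace M] [TopologicalSpace X] [TopologicalSpace Y] {e : X → M} (he : IsInducing e)
    {n : ℕ} {H : ℕ → X → Set Y} (hne : ∀ m x, (H m x).Nonempty)
    (husc : ∀ m, UpperHemicontinuous (H m))
    (huv : ∀ m < n, ∀ x, IsUVConnectedPair L (H (m + 1) x) (H m x))
    {P₀ : X → Set M} {U₀ : X → Set Y} (h₀ : IsGraphCover e (H 0) P₀ U₀) :
    ∃ (P Q : ℕ → X → Set M) (U V : ℕ → X → Set Y), P 0 = P₀ ∧ U 0 = U₀ ∧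
      (∀ m x, IsOpen (Q m x)) ∧ (∀ m x, Q m x ⊆ P m x) ∧ (∀ m, range e ⊆ ⋃ x, Q m x) ∧
      (∀ m x, IsLConnectedPair L (V m x) (U m x)) ∧
      ∀ m < n, ∀ x y, (Q m x ∩ P (m + 1) y).Nonempty → U (m + 1) y ⊆ V m x := by
  let D : ℕ → Type u := fun m => {p : (X → Set M) × (X → Set Y) // IsGraphCover e (H m) p.1 p.2}
  have hstep : ∀ (m : ℕ) (d : D m), ∃ (d' : D (m + 1)) (Q : X → Set M) (V : X → Set Y),
      (∀ x, IsOpen (Q x)) ∧ (∀ x, Q x ⊆ d.1.1 x) ∧ (range e ⊆ ⋃ x, Q x) ∧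
      (∀ x, IsLConnectedPair L (V x) (d.1.2 x)) ∧
      (m < n → ∀ x y, (Q x ∩ d'.1.1 y).Nonempty → d'.1.2 y ⊆ V x) := by
    rintro m ⟨⟨P, U⟩, hd⟩
    have hU : ∀ x, U x ∈ 𝓝ˢ (H m x) := fun x => hd.mem_nhdsSet x x (hd.mem x)
    by_cases hm : m < n
    · choose V hV hVU using fun x => (huv m hm x).2 (U x) (hU x)
      obtain ⟨Q, P', U', h1, h2, h3, h4, h5⟩ :=
        (husc (m + 1)).exists_isGraphCover he hd.isOpen hd.mem hV
      exact ⟨⟨(P', U'), h4⟩, Q, V, h1, h2, h3, hVU, fun _ => h5⟩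
    · obtain ⟨Q, P', U', h1, h2, h3, h4, -⟩ := (husc (m + 1)).exists_isGraphCover he hd.isOpen
        hd.mem (V := fun _ => univ) fun x => Filter.univ_mem
      exact ⟨⟨(P', U'), h4⟩, Q, fun _ => ∅, h1, h2, h3, fun x => .empty_left L
        ((hne m x).mono (subset_of_mem_nhdsSet (hU x))), fun h => (hm h).elim⟩
  choose next Q V h1 h2 h3 h4 h5 using hstep
  let d : ∀ m, D m := fun m => Nat.rec ⟨(P₀, U₀), h₀⟩ (fun m d => next m d) m
  exact ⟨fun m => (d m).1.1, fun m => Q m (d m), fun m => (d m).1.2, fun m => V m (d m), rfl, rfl,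
    fun m => h1 m (d m), fun m => h2 m (d m), fun m => h3 m (d m), fun m => h4 m (d m),
    fun m hm => h5 m (d m) hm⟩

/-! ### The lifting theorem -/

theorem mainTheorem9 {L : Type v} [TopologicalSpace L] [T2Space L]
    [Topology.CWComplex (Set.univ : Set L)] (n : ℕ) (hL : ExtTypeLE.{u} L (StdSphere n))
    {X Y : Type u} [MetricSpace X] [MetricSpace Y] (f : Y → X)
    (hf : Continuous f) (hsurj : Function.Surjective f)
    (hF : AdmitsCompactUVFiltration L n (fun x : X => f ⁻¹' {x})) :
    IsApproxLInvertible L f := by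
  classical
  obtain ⟨G, hfil, hcpt, huv⟩ := hF
  intro M N _ _ _ e j he hj hje W hW
  let H : ℕ → X → Set Y := fun m => G ⟨n - m, by omega⟩
  have hH0 : ∀ x, ∀ y ∈ H 0 x, f y = x := fun x y hy => hfil.last x hy
  have hHuv : ∀ m < n, ∀ x, IsUVConnectedPair L (H (m + 1) x) (H m x) := by
    intro m hm x
    have h1 : (⟨n - m, by omega⟩ : Fin (n + 1)) = (⟨n - (m + 1), by omega⟩ : Fin n).succ :=
      Fin.ext (by simp only [Fin.val_succ]; omega)
    have h2 := huv ⟨n - (m + 1), by omega⟩ x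
    rw [← h1] at h2
    exact h2
  -- Compactness of `H 0 x` enters through the tube lemma: `W` contains a product neighbourhood of
  -- `{e x}` times the image of `H 0 x` in `N`.
  have htube : ∀ x, ∃ (P : Set M) (U : Set Y), IsOpen P ∧ e x ∈ P ∧
      (∀ x', e x' ∈ P → U ∈ 𝓝ˢ (H 0 x')) ∧ ∀ m ∈ P, ∀ y ∈ U, (m, (j y).2) ∈ W := by
    intro x
    have hq : Continuous fun y => (j y).2 := continuous_snd.comp hj.continuous
    obtain ⟨u, v, huo, hvo, hxu, hv, huvW⟩ := generalized_tube_lemma (isCompact_singleton (x := e x))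
      (((hcpt _).isCompact x).image hq : IsCompact ((fun y => (j y).2) '' H 0 x))
      (isOpen_interior (s := W)) (by
        rintro ⟨m, q⟩ ⟨hm, y, hy, rfl⟩
        obtain rfl : m = e x := hm
        have h1 : (e x, (j y).2) = j y := Prod.ext (by rw [hje, hH0 x y hy]) rfl
        change (e x, (j y).2) ∈ _
        rw [h1]
        exact (subset_interior_iff_mem_nhdsSet.2 hW) (mem_range_self y))
    have hU : (fun y => (j y).2) ⁻¹' v ∈ 𝓝ˢ (H 0 x) :=
      (hvo.preimage hq).mem_nhdsSet.2 (image_subset_iff.1 hv)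
    obtain ⟨O, hOu, hOo, hxO, hO⟩ := (hcpt _).usc.exists_isOpen he.isInducing hU
      (huo.mem_nhds (hxu rfl))
    exact ⟨O, _, hOo, hxO, hO, fun m hm y hy => interior_subset (huvW ⟨hOu hm, hy⟩)⟩
  choose P₀ U₀ hP₀o hP₀ hU₀ hW₀ using htube
  obtain ⟨P, Q, U, V, rfl, rfl, hQo, hQP, hQc, hVU, hUV⟩ := exists_nested_isGraphCover L
    he.isInducing (H := H) (fun m x => (hcpt _).nonempty x) (fun m => (hcpt _).usc) hHuv
    ⟨hP₀o, hP₀, hU₀⟩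
  refine ⟨⋂ m : Fin (n + 1), ⋃ x, Q m x, isOpen_iInter_of_finite fun m => isOpen_iUnion (hQo m),
    subset_iInter fun m => hQc m, fun Z _ _ _ hZ g hg => ?_⟩
  obtain ⟨κ, F, hFc, hFf, hFu, hFa, hFn⟩ := (hL Z hZ).exists_closed_refinement
    -- Indexing by tuples puts each `F k` inside one `g ⁻¹' Q m x` at every level `m`
    -- simultaneously.
    (u := fun a : Fin (n + 1) → X => ⋂ m : Fin (n + 1), g ⁻¹' Q m (a m))
    (fun a => isOpen_iInter_of_finite fun m => (hQo m _).preimage g.continuous)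
    (eq_univ_of_forall fun z => by
      choose a ha using fun m => mem_iUnion.1 (mem_iInter.1 (hg z) m)
      exact mem_iUnion.2 ⟨a, mem_iInter.2 ha⟩)
  choose a ha using hFa
  rcases isEmpty_or_nonempty Z with hZe | ⟨⟨z₀⟩⟩
  · exact ⟨⟨isEmptyElim, by fun_prop⟩, isEmptyElim, isEmptyElim⟩
  have hX : Nonempty X := by
    obtain ⟨k, -⟩ := mem_iUnion.1 (hFu.ge (mem_univ z₀))
    exact ⟨a k 0⟩
  have hY : Nonempty Y := hX.map fun x => (hsurj x).choose
  -- Any member of `σ` may supply the centre: `hUV` relates any two centres whose sets `Q m` and `P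
  -- (m + 1)` meet. A `σ` of cardinality `m` uses level `m - 1`.
  let c : Finset κ → X := fun σ =>
    if h : σ.Nonempty then a h.choose (Fin.ofNat (n + 1) (σ.card - 1)) else Classical.arbitrary X
  have hc : ∀ σ : Finset κ, σ.Nonempty → σ.card ≤ n + 1 → ∀ z ∈ ⋂ k ∈ σ, F k,
      g z ∈ Q (σ.card - 1) (c σ) := by
    intro σ hσ hcard z hz
    have h1 := mem_iInter.1 (ha _ (mem_iInter₂.1 hz _ hσ.choose_spec))
      (Fin.ofNat (n + 1) (σ.card - 1))
    have h2 : ((Fin.ofNat (n + 1) (σ.card - 1) : Fin (n + 1)) : ℕ) = σ.card - 1 :=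
      Nat.mod_eq_of_lt (by omega)
    simp only [c, hσ, dif_pos]
    rwa [mem_preimage, h2] at h1
  obtain ⟨h, hh, hhU⟩ := exists_continuous_of_closed_cover hFc hFf hFu hFn
    (fun σ => U (σ.card - 1) (c σ)) (fun σ => V (σ.card - 1) (c σ))
    (fun σ _ _ A hAσ hA h hh hV => (hVU _ _).exists_extension hZ
      (isClosed_biInter fun k _ => hFc k) hA hAσ hh hV)
    (fun σ τ hσ hστ hcard hτ ⟨z, hz⟩ => by
      have hpos := hσ.card_pos
      have h1 := hc σ hσ (by omega) z (biInter_subset_biInter_left hστ hz)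
      have h2 := hQP _ _ (hc τ (hσ.mono hστ) hτ z hz)
      have h3 : τ.card - 1 = σ.card - 1 + 1 := by omega
      rw [h3] at h2 ⊢
      exact hUV _ (by omega) _ _ ⟨g z, h1, h2⟩)
  refine ⟨⟨fun z => (g z, (j (h z)).2), by
    exact g.continuous.prodMk (continuous_snd.comp (hj.continuous.comp hh))⟩, fun z => ?_,
    fun z => rfl⟩
  obtain ⟨k, hk⟩ := mem_iUnion.1 (hFu.ge (mem_univ z))
  have h1 := hQP _ _ (hc {k} (Finset.singleton_nonempty k) (by simp) z (by simpa using hk))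
  exact hW₀ _ _ h1 _ (hhU k hk)
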